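/- Let $K$ be a CM field (a totally imaginary quadratic extension of a totally real number field) such that $K/\mathbb{Q}$ is Galois with cyclic Galois group. Let $f$ be the least positive integer such that $K$ is isomorphic to a subfield of the cyclotomic field $\mathbb{Q}(\zeta_f)$. For a rational prime $p$, the decomposition type of $p$ in $K$ is the multiset of pairs $(e(\mathfrak{P}), f(\mathfrak{P}))$ of ramification index and inertia degree, where $\mathfrak{P}$ runs over the primes of $\mathcal{O}_K$ above $p$. Then the decomposition type of a prime $p$ unramified in $K$ depends only on the residue class of $p$ modulo $f$: if $p$ and $q$ are primes unramified in $K$ with $p \equiv q \pmod f$, then $p$ and $q$ have the same decomposition type in $K$. -/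

import Mathlib

/-!
Embed `K` in `L = ℚ(ζₙ)` and let `H` be the image of `Gal(L/K)` in `Gal(L/ℚ) ≃ (ℤ/nℤ)ˣ`. For
`p ∤ n`, the decomposition group of `p` in `L/ℚ` is generated by the class of `p`, so the one in
`L/K` is its intersection with `H`. As `p` is unramified in `L`, counting shows that the inertia
degree of `p` in `K` is the order of `p` in `(ℤ/nℤ)ˣ ⧸ H`, and since `K/ℚ` is Galois this degree
determines the decomposition type. If `p ∣ n`, then `p ≡ q` modulo `n` forces `p = q`.
-/

open scoped NumberField

/-- The decomposition type of the rational prime `p` in the number field `K`: the multiset of pairs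
`(e(P), f(P))` (ramification index and inertia degree), one for each prime `P` of `𝓞 K` over `p`. -/
noncomputable def decompositionType (K : Type*) [Field K] [NumberField K] (p : ℕ) :
    Multiset (ℕ × ℕ) :=
  (IsDedekindDomain.primesOverFinset (Ideal.span {(p : ℤ)}) (𝓞 K)).val.map
    fun P => (P.ramificationIdx ℤ, P.inertiaDeg ℤ)

/-- The positive integers `n` such that `K` is (isomorphic to) a subfield of `ℚ(ζ_n)`. -/
def cyclotomicLevels (K : Type*) [Field K] [NumberField K] : Set ℕ :=
  {n | 0 < n ∧ Nonempty (K →ₐ[ℚ] CyclotomicField n ℚ)}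

open Ideal IsCyclotomicExtension.Rat MulAction

open scoped Pointwise

theorem orderOf_mk_range_mul_natCard_comap_zpowers {G A : Type*} [Group G] [Group A] {φ : G →* A}
    (hφ : Function.Injective φ) [φ.range.Normal] (a : A) :
    orderOf (a : A ⧸ φ.range) * Nat.card ((Subgroup.zpowers a).comap φ) = orderOf a := by
  have card_comap : Nat.card ((Subgroup.zpowers a).comap φ) =
      Nat.card (φ.range.subgroupOf (Subgroup.zpowers a)) := by
    rw [← Subgroup.card_map_of_injective hφ, Subgroup.map_comap_eq, ← Subgroup.inf_subgroupOf_right,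
      Nat.card_congr (Subgroup.subgroupOfEquivOfLe inf_le_right).toEquiv]
  have orderOf_mk : orderOf (a : A ⧸ φ.range) = φ.range.relIndex (Subgroup.zpowers a) := by
    rw [← Nat.card_zpowers, ← QuotientGroup.mk'_apply, ← MonoidHom.map_zpowers,
      ← Subgroup.relIndex_ker, QuotientGroup.ker_mk']
  rw [card_comap, orderOf_mk, Subgroup.relIndex, Subgroup.index_mul_card, Nat.card_zpowers]

theorem decompositionType_eq_replicate (K : Type*) [Field K] [NumberField K] [IsGalois ℚ K]
    (p : ℕ) [Fact p.Prime] :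
    decompositionType K p = Multiset.replicate
      (Nat.card Gal(K/ℚ) / ((span {(p : ℤ)}).ramificationIdxIn (𝓞 K) *
        (span {(p : ℤ)}).inertiaDegIn (𝓞 K)))
      ((span {(p : ℤ)}).ramificationIdxIn (𝓞 K), (span {(p : ℤ)}).inertiaDegIn (𝓞 K)) := by
  have hp0 : span {(p : ℤ)} ≠ ⊥ := by simpa using (Fact.out : p.Prime).ne_zero
  refine Multiset.eq_replicate.mpr ⟨?_, fun x hx ↦ ?_⟩
  · have ef_pos : 0 < (span {(p : ℤ)}).ramificationIdxIn (𝓞 K) *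
        (span {(p : ℤ)}).inertiaDegIn (𝓞 K) :=
      Nat.pos_of_ne_zero
        (mul_ne_zero (ramificationIdxIn_ne_zero Gal(K/ℚ)) (inertiaDegIn_ne_zero Gal(K/ℚ)))
    rw [decompositionType, Multiset.card_map, Finset.card_val, ← Set.ncard_coe_finset,
      IsDedekindDomain.coe_primesOverFinset hp0,
      ← ncard_primesOver_mul_ramificationIdxIn_mul_inertiaDegIn (span {(p : ℤ)}) (𝓞 K) Gal(K/ℚ),
      Nat.mul_div_cancel _ ef_pos]
  · obtain ⟨P, hP, rfl⟩ := Multiset.mem_map.mp hx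
    obtain ⟨_, _⟩ := (IsDedekindDomain.mem_primesOverFinset_iff hp0 _).mp hP
    rw [ramificationIdxIn_eq_ramificationIdx _ P Gal(K/ℚ), inertiaDegIn_eq_inertiaDeg _ P Gal(K/ℚ)]

section CyclotomicSubfield

variable (n : ℕ) [NeZero n] (K L : Type*) [Field K] [NumberField K] [Field L] [NumberField L]
  [Algebra K L] [IsCyclotomicExtension {n} ℚ L] (p : ℕ) [Fact p.Prime]

/-- The homomorphism `Gal(L/K) → (ℤ/nℤ)ˣ` giving the action on the `n`-th roots of unity, where
`L = ℚ(ζₙ)` and `K` is a subfield of `L`. It identifies `Gal(L/K)` with the subgroup of `(ℤ/nℤ)ˣ`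
attached to `K` by the Galois correspondence. -/
noncomputable def relativeCyclotomicCharacter : Gal(L/K) →* (ZMod n)ˣ :=
  (galEquivZMod n L).toMonoidHom.comp (AlgEquiv.restrictScalarsHom ℚ)

theorem relativeCyclotomicCharacter_injective :
    Function.Injective (relativeCyclotomicCharacter n K L) :=
  (galEquivZMod n L).injective.comp (AlgEquiv.restrictScalarsHom_injective ℚ)

theorem stabilizer_eq_comap_zpowers (hpn : p.Coprime n) (Q : Ideal (𝓞 L)) [Q.IsMaximal]
    [Q.LiesOver (span {(p : ℤ)})] :
    stabilizer Gal(L/K) Q = (Subgroup.zpowers (ZMod.unitOfCoprime p hpn)).comap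
      (relativeCyclotomicCharacter n K L) := by
  rw [← galEquivZMod_stabilizer n L p Q hpn]
  ext σ
  exact (Subgroup.mem_map_iff_mem (K := stabilizer Gal(L/ℚ) Q) (x := σ.restrictScalars ℚ)
    (galEquivZMod n L).injective).symm

variable {n p}

theorem ramificationIdxIn_mul_ramificationIdxIn_eq_one (hpn : p.Coprime n) (P : Ideal (𝓞 K))
    [P.IsPrime] [P.LiesOver (span {(p : ℤ)})] :
    (span {(p : ℤ)}).ramificationIdxIn (𝓞 K) * P.ramificationIdxIn (𝓞 L) = 1 := by
  have : IsAbelianGalois ℚ L := IsCyclotomicExtension.isAbelianGalois {n} ℚ L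
  have : IsAbelianGalois ℚ K := .tower_bot ℚ K L
  have : IsAbelianGalois K L := .tower_top ℚ K L
  rw [ramificationIdxIn_mul_ramificationIdxIn P Gal(K/ℚ) (𝓞 L) Gal(L/ℚ) Gal(L/K),
    ramificationIdxIn_eq_of_not_dvd p L ((Fact.out : p.Prime).coprime_iff_not_dvd.mp hpn)]

theorem inertiaDegIn_eq_natCard_comap_zpowers (hpn : p.Coprime n) (P : Ideal (𝓞 K)) [P.IsMaximal]
    [P.LiesOver (span {(p : ℤ)})] :
    P.inertiaDegIn (𝓞 L) = Nat.card ((Subgroup.zpowers (ZMod.unitOfCoprime p hpn)).comap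
      (relativeCyclotomicCharacter n K L)) := by
  have : IsAbelianGalois ℚ L := IsCyclotomicExtension.isAbelianGalois {n} ℚ L
  have : IsAbelianGalois K L := .tower_top ℚ K L
  obtain ⟨⟨Q, _, _⟩⟩ := P.nonempty_primesOver (S := 𝓞 L)
  have : Q.IsMaximal := .of_liesOver_isMaximal Q P
  have : Q.LiesOver (span {(p : ℤ)}) := .trans Q P _
  rw [← stabilizer_eq_comap_zpowers n K L p hpn Q, card_stabilizer_eq P,
    Nat.eq_one_of_mul_eq_one_left (ramificationIdxIn_mul_ramificationIdxIn_eq_one K L hpn P),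
    one_mul]

theorem inertiaDegIn_eq_orderOf_mk (hpn : p.Coprime n) :
    (span {(p : ℤ)}).inertiaDegIn (𝓞 K) =
      orderOf
        (ZMod.unitOfCoprime p hpn : (ZMod n)ˣ ⧸ (relativeCyclotomicCharacter n K L).range) := by
  have : IsAbelianGalois ℚ L := IsCyclotomicExtension.isAbelianGalois {n} ℚ L
  have : IsAbelianGalois ℚ K := .tower_bot ℚ K L
  have : IsAbelianGalois K L := .tower_top ℚ K L
  obtain ⟨⟨P, _, _⟩⟩ := (span {(p : ℤ)}).nonempty_primesOver (S := 𝓞 K)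
  have : P.IsMaximal := .of_liesOver_isMaximal P (span {(p : ℤ)})
  have inertiaDegIn_cyclotomic :
      (span {(p : ℤ)}).inertiaDegIn (𝓞 L) = orderOf (ZMod.unitOfCoprime p hpn) := by
    rw [inertiaDegIn_eq_of_not_dvd p L ((Fact.out : p.Prime).coprime_iff_not_dvd.mp hpn),
      ← orderOf_units, ZMod.coe_unitOfCoprime]
  refine Nat.eq_of_mul_eq_mul_right (Nat.card_pos (α := (Subgroup.zpowers
    (ZMod.unitOfCoprime p hpn)).comap (relativeCyclotomicCharacter n K L))) ?_
  rw [orderOf_mk_range_mul_natCard_comap_zpowers (relativeCyclotomicCharacter_injective n K L),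
    ← inertiaDegIn_eq_natCard_comap_zpowers K L hpn P,
    inertiaDegIn_mul_inertiaDegIn _ P Gal(K/ℚ) (𝓞 L) Gal(L/ℚ) Gal(L/K), inertiaDegIn_cyclotomic]

theorem decompositionType_eq_replicate_orderOf_mk (hpn : p.Coprime n) :
    decompositionType K p = Multiset.replicate
      (Nat.card Gal(K/ℚ) / orderOf
        (ZMod.unitOfCoprime p hpn : (ZMod n)ˣ ⧸ (relativeCyclotomicCharacter n K L).range))
      (1, orderOf
        (ZMod.unitOfCoprime p hpn : (ZMod n)ˣ ⧸ (relativeCyclotomicCharacter n K L).range)) := by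
  have : IsAbelianGalois ℚ L := IsCyclotomicExtension.isAbelianGalois {n} ℚ L
  have : IsAbelianGalois ℚ K := .tower_bot ℚ K L
  obtain ⟨⟨P, _, _⟩⟩ := (span {(p : ℤ)}).nonempty_primesOver (S := 𝓞 K)
  rw [decompositionType_eq_replicate,
    Nat.eq_one_of_mul_eq_one_right (ramificationIdxIn_mul_ramificationIdxIn_eq_one K L hpn P),
    one_mul, inertiaDegIn_eq_orderOf_mk K L hpn]

end CyclotomicSubfield

theorem decompositionType_eq_of_modEq_of_coprime (n : ℕ) [NeZero n] (K L : Type*) [Field K]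
    [NumberField K] [Field L] [NumberField L] [Algebra K L] [IsCyclotomicExtension {n} ℚ L]
    {p q : ℕ} (hp : p.Prime) (hq : q.Prime) (hpn : p.Coprime n) (hpq : p ≡ q [MOD n]) :
    decompositionType K p = decompositionType K q := by
  have : Fact p.Prime := ⟨hp⟩
  have : Fact q.Prime := ⟨hq⟩
  have hqn : q.Coprime n := hpq.gcd_eq.symm.trans hpn
  have unit_eq : ZMod.unitOfCoprime p hpn = ZMod.unitOfCoprime q hqn :=
    Units.ext ((ZMod.natCast_eq_natCast_iff p q n).mpr hpq)
  rw [decompositionType_eq_replicate_orderOf_mk K L hpn,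
    decompositionType_eq_replicate_orderOf_mk K L hqn, unit_eq]

theorem mainTheorem6_general {K : Type*} [Field K] [NumberField K] {n : ℕ}
    (hn : n ∈ cyclotomicLevels K) {p q : ℕ} (hp : p.Prime) (hq : q.Prime) (hpq : p ≡ q [MOD n]) :
    decompositionType K p = decompositionType K q := by
  obtain ⟨hn_pos, ⟨φ⟩⟩ := hn
  have : NeZero n := ⟨hn_pos.ne'⟩
  by_cases hpn : p.Coprime n
  · let _ : Algebra K (CyclotomicField n ℚ) := φ.toRingHom.toAlgebra
    -- Instance search does not see that the `ℚ`-algebra structure built into `CyclotomicField` is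
    -- definitionally the one of a division ring of characteristic zero.
    have : @IsCyclotomicExtension {n} ℚ (CyclotomicField n ℚ) _ _ DivisionRing.toRatAlgebra :=
      CyclotomicField.isCyclotomicExtension n ℚ
    exact decompositionType_eq_of_modEq_of_coprime n K (CyclotomicField n ℚ) hp hq hpn hpq
  · have hpn_dvd : p ∣ n := not_not.mp (hpn ∘ hp.coprime_iff_not_dvd.mpr)
    rw [(Nat.prime_dvd_prime_iff_eq hp hq).mp ((hpq.dvd_iff hpn_dvd).mp dvd_rfl)]

theorem mainTheorem6 (K : Type*) [Field K] [NumberField K] [NumberField.IsCMField K]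
    [IsGalois ℚ K] [IsCyclic Gal(K/ℚ)]
    (f : ℕ) (hf : IsLeast (cyclotomicLevels K) f)
    (p q : ℕ) (hp : p.Prime) (hq : q.Prime)
    (hpK : Algebra.IsUnramifiedIn (𝓞 K) (Ideal.span {(p : ℤ)}))
    (hqK : Algebra.IsUnramifiedIn (𝓞 K) (Ideal.span {(q : ℤ)}))
    (hpq : p ≡ q [MOD f]) :
    decompositionType K p = decompositionType K q :=
  mainTheorem6_general hf.1 hp hq hpq
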